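/- All Hilbert spaces are complex and separable, possibly infinite-dimensional; $\mathcal D_{\le}(\mathcal H)$ denotes the set of subnormalised states on $\mathcal H$, i.e. positive semidefinite operators $\rho$ with $\operatorname{Tr}\rho\le 1$. For $\rho,\tau\in\mathcal D_\le(\mathcal H)$ let $$F(\rho,\tau)=\Big(\operatorname{Tr}\big|\sqrt\rho\sqrt\tau\big|+\sqrt{(1-\operatorname{Tr}\rho)(1-\operatorname{Tr}\tau)}\Big)^2,\qquad P(\rho,\tau)=\sqrt{1-F(\rho,\tau)}$$ be the generalised fidelity and the purified distance. For an operator $\rho_{AB}\in\mathcal D_\le(\mathcal H_A\otimes\mathcal H_B)$ and $\epsilon\ge 0$ define, with values in $[-\infty,\infty]$, $$H_{\min}(A|B)_\rho=\sup_{\sigma_B\in\mathcal D_\le(\mathcal H_B)}\sup\{\lambda\in\mathbb R:\rho_{AB}\le e^{-\lambda}\,\mathbb 1_A\otimes\sigma_B\},$$ $$H^\epsilon_{\min}(A|B)_\rho=\sup\{H_{\min}(A|B)_{\tau}:\tau\in\mathcal D_\le(\mathcal H_A\otimes\mathcal H_B),\ P(\tau,\rho_{AB})\le\epsilon\}.$$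 **Lemma.** Let $\mathcal H_A,\mathcal H_B$ be separable Hilbert spaces, let $X,Y$ be classical registers with countable alphabets (represented by the Hilbert spaces $\ell^2(X)$ and $\ell^2(Y)$), and let $$\rho_{ABXY}=\sum_{x,y}\rho_{AB}^{x,y}\otimes|x\rangle\langle x|_X\otimes|y\rangle\langle y|_Y,\qquad \rho_{AB}^{x,y}\ge 0,\quad \sum_{x,y}\operatorname{Tr}\rho_{AB}^{x,y}\le 1,$$ be a subnormalised cq-state. For an event $\Omega\subseteq X\times Y$ put $$\rho_{ABXY\wedge\Omega}=\sum_{(x,y)\in\Omega}\rho_{AB}^{x,y}\otimes|x\rangle\langle x|_X\otimes|y\rangle\langle y|_Y .$$ Then for every $\epsilon>0$ $$H^\epsilon_{\min}(AX|B)_{\rho\wedge\Omega}\ \ge\ H^\epsilon_{\min}(AX|B)_{\rho},$$ where both sides are evaluated on the marginals on $AXB$ obtained by the partial trace over $Y$. -/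

import Mathlib

open scoped ENNReal TensorProduct

noncomputable section

namespace CQ

/-! ### Hilbert spaces of composite systems and classical registers -/

/-- The Hilbert space tensor product `H ⊗ K`: the completion of the algebraic tensor product
with respect to the inner product `⟪h ⊗ k, h' ⊗ k'⟫ = ⟪h, h'⟫ * ⟪k, k'⟫`. -/
def HTensor (H K : Type*) [NormedAddCommGroup H] [InnerProductSpace ℂ H]
    [NormedAddCommGroup K] [InnerProductSpace ℂ K] : Type _ :=
  UniformSpace.Completion (H ⊗[ℂ] K)

section

variable (H K : Type*) [NormedAddCommGroup H] [InnerProductSpace ℂ H]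
  [NormedAddCommGroup K] [InnerProductSpace ℂ K]

instance : NormedAddCommGroup (HTensor H K) :=
  inferInstanceAs (NormedAddCommGroup (UniformSpace.Completion (H ⊗[ℂ] K)))

instance : InnerProductSpace ℂ (HTensor H K) :=
  inferInstanceAs (InnerProductSpace ℂ (UniformSpace.Completion (H ⊗[ℂ] K)))

instance : CompleteSpace (HTensor H K) :=
  inferInstanceAs (CompleteSpace (UniformSpace.Completion (H ⊗[ℂ] K)))

end

/-- The elementary tensor `h ⊗ k` in the Hilbert space tensor product. -/
def tmul {H K : Type*} [NormedAddCommGroup H] [InnerProductSpace ℂ H]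
    [NormedAddCommGroup K] [InnerProductSpace ℂ K] (h : H) (k : K) : HTensor H K :=
  ((h ⊗ₜ[ℂ] k : H ⊗[ℂ] K) : UniformSpace.Completion (H ⊗[ℂ] K))

/-- The tensor product `T ⊗ S` of bounded operators: the unique bounded operator with
`(T ⊗ S) (h ⊗ k) = T h ⊗ S k`. -/
def opTensor {H H' K K' : Type*}
    [NormedAddCommGroup H] [InnerProductSpace ℂ H] [NormedAddCommGroup H'] [InnerProductSpace ℂ H']
    [NormedAddCommGroup K] [InnerProductSpace ℂ K] [NormedAddCommGroup K'] [InnerProductSpace ℂ K']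
    (T : H →L[ℂ] H') (S : K →L[ℂ] K') : HTensor H K →L[ℂ] HTensor H' K' :=
  ContinuousLinearMap.completion (TensorProduct.mapL T S)

theorem opTensor_tmul {H H' K K' : Type*}
    [NormedAddCommGroup H] [InnerProductSpace ℂ H] [NormedAddCommGroup H'] [InnerProductSpace ℂ H']
    [NormedAddCommGroup K] [InnerProductSpace ℂ K] [NormedAddCommGroup K'] [InnerProductSpace ℂ K']
    (T : H →L[ℂ] H') (S : K →L[ℂ] K') (h : H) (k : K) :
    opTensor T S (tmul h k) = tmul (T h) (S k) := by
  exact (ContinuousLinearMap.completion_apply_coe _ _).trans (by rw [TensorProduct.mapL_tmul]; rfl)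

theorem inner_tmul {H K : Type*} [NormedAddCommGroup H] [InnerProductSpace ℂ H]
    [NormedAddCommGroup K] [InnerProductSpace ℂ K] (h h' : H) (k k' : K) :
    inner ℂ (tmul h k) (tmul h' k') = inner ℂ h h' * inner ℂ k k' :=
  (UniformSpace.Completion.inner_coe _ _).trans (TensorProduct.inner_tmul ..)

/-- The Hilbert space `ℓ²(C)` of a classical register with alphabet `C`. -/
abbrev Reg (C : Type*) : Type _ := lp (fun _ : C => ℂ) 2

/-- The computational basis vector `|c⟩` of a classical register. -/
def ket {C : Type*} (c : C) : Reg C := by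
  classical exact lp.single 2 c (1 : ℂ)

/-- The projection `|c⟩⟨c|` of a classical register. -/
def ketbra {C : Type*} (c : C) : Reg C →L[ℂ] Reg C :=
  InnerProductSpace.rankOne ℂ (ket c) (ket c)

/-- The isometry `1 ⊗ |c⟩ : H → H ⊗ ℓ²(C)`, `h ↦ h ⊗ |c⟩`. -/
def addKet (H : Type*) [NormedAddCommGroup H] [InnerProductSpace ℂ H] {C : Type*} (c : C) :
    H →L[ℂ] HTensor H (Reg C) :=
  (UniformSpace.Completion.toComplL :
    (H ⊗[ℂ] Reg C) →L[ℂ] UniformSpace.Completion (H ⊗[ℂ] Reg C)) ∘L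
      (TensorProduct.mkL ℂ H (Reg C)).flip (ket c)

theorem addKet_apply (H : Type*) [NormedAddCommGroup H] [InnerProductSpace ℂ H] {C : Type*}
    (c : C) (h : H) : addKet H c h = tmul h (ket c) := rfl

/-! ### Trace, subnormalised states, purified distance -/

/-- The trace `∑ᵢ ⟪eᵢ, T eᵢ⟫ ∈ [0, ∞]` of a positive operator `T`, for an orthonormal basis `e`.
For positive `T` it does not depend on the basis, see `posTrace_eq`. -/
def posTrace {H : Type*} [NormedAddCommGroup H] [InnerProductSpace ℂ H] [CompleteSpace H]
    (T : H →L[ℂ] H) : ℝ≥0∞ :=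
  ∑' e : (exists_hilbertBasis ℂ H).choose, ENNReal.ofReal (inner ℂ (e : H) (T e)).re

theorem re_inner_eq {H : Type*} [NormedAddCommGroup H] [InnerProductSpace ℂ H] [CompleteSpace H]
    {T : H →L[ℂ] H} (hT : 0 ≤ T) (v : H) :
    (inner ℂ v (T v)).re = ‖CFC.sqrt T v‖ ^ 2 := by
  have hS : (CFC.sqrt T) * (CFC.sqrt T) = T := CFC.sqrt_mul_sqrt_self T hT
  have hpos : (CFC.sqrt T).IsPositive :=
    (ContinuousLinearMap.nonneg_iff_isPositive _).1 (CFC.sqrt_nonneg T)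
  have hsymm := hpos.isSelfAdjoint.isSymmetric
  conv_lhs => rw [← hS]
  rw [mul_apply_eq_comp]
  have := hsymm v (CFC.sqrt T v)
  simp only [ContinuousLinearMap.coe_coe] at this
  rw [← this, inner_self_eq_norm_sq_to_K]
  norm_cast

theorem ofReal_norm_sq_eq {H : Type*} [NormedAddCommGroup H] [InnerProductSpace ℂ H]
    {ι : Type*} (b : HilbertBasis ι ℂ H) (v : H) :
    ENNReal.ofReal (‖v‖ ^ 2) = ∑' i, ENNReal.ofReal (‖inner ℂ (b i) v‖ ^ 2) := by
  have h := b.orthonormal.inner_products_summable (x := v)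
  rw [← ENNReal.ofReal_tsum_of_nonneg (fun i => by positivity) h]
  congr 1
  have h2 := b.hasSum_inner_mul_inner v v
  have h3 := h2.mapL Complex.reCLM
  have h4 : ∀ i, Complex.reCLM (inner ℂ v (b i) * inner ℂ (b i) v)
      = ‖inner ℂ (b i) v‖ ^ 2 := by
    intro i
    rw [← inner_conj_symm v (b i), ← Complex.normSq_eq_conj_mul_self]
    rw [Complex.reCLM_apply, Complex.ofReal_re, Complex.normSq_eq_norm_sq]
  simp only [h4] at h3
  rw [h3.tsum_eq, inner_self_eq_norm_sq_to_K]
  norm_cast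

/-- The trace of a positive operator does not depend on the orthonormal basis. -/
theorem posTrace_eq {H : Type*} [NormedAddCommGroup H] [InnerProductSpace ℂ H] [CompleteSpace H]
    {T : H →L[ℂ] H} (hT : 0 ≤ T) {ι : Type*} (b : HilbertBasis ι ℂ H) :
    posTrace T = ∑' i, ENNReal.ofReal (inner ℂ (b i) (T (b i))).re := by
  obtain ⟨e, he⟩ := (exists_hilbertBasis ℂ H).choose_spec
  have hpos : (CFC.sqrt T).IsPositive :=
    (ContinuousLinearMap.nonneg_iff_isPositive _).1 (CFC.sqrt_nonneg T)
  have hsymm := hpos.isSelfAdjoint.isSymmetric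
  have key : ∀ i j, ‖inner ℂ (b j) (CFC.sqrt T (e i))‖ = ‖inner ℂ (e i) (CFC.sqrt T (b j))‖ := by
    intro i j
    have := hsymm (b j) (e i)
    simp only [ContinuousLinearMap.coe_coe] at this
    rw [← this, norm_inner_symm]
  have h1 : posTrace T = ∑' i, ENNReal.ofReal (‖CFC.sqrt T (e i)‖ ^ 2) := by
    simp only [posTrace, re_inner_eq hT, he]
  rw [h1]
  simp only [re_inner_eq hT]
  simp_rw [ofReal_norm_sq_eq b (CFC.sqrt T (e _)), key]
  rw [ENNReal.tsum_comm]
  simp_rw [← ofReal_norm_sq_eq e]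

/-- `D_≤(H)`: positive operators of trace at most one. -/
def subStates (H : Type*) [NormedAddCommGroup H] [InnerProductSpace ℂ H] [CompleteSpace H] :
    Set (H →L[ℂ] H) :=
  {ρ | 0 ≤ ρ ∧ posTrace ρ ≤ 1}

/-- The generalised fidelity
`F(ρ, σ) = (Tr |√ρ √σ| + √((1 - Tr ρ) (1 - Tr σ)))²` of subnormalised states. -/
def fidelity {H : Type*} [NormedAddCommGroup H] [InnerProductSpace ℂ H] [CompleteSpace H]
    (ρ σ : H →L[ℂ] H) : ℝ :=
  ((posTrace (CFC.abs (CFC.sqrt ρ * CFC.sqrt σ))).toReal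
    + √((1 - (posTrace ρ).toReal) * (1 - (posTrace σ).toReal))) ^ 2

/-- The purified distance `P(ρ, σ) = √(1 - F(ρ, σ))`. -/
def purifiedDist {H : Type*} [NormedAddCommGroup H] [InnerProductSpace ℂ H] [CompleteSpace H]
    (ρ σ : H →L[ℂ] H) : ℝ :=
  √(1 - fidelity ρ σ)

/-- The ball `B^ε(ρ)` of subnormalised states at purified distance at most `ε` from `ρ`. -/
def smoothBall {H : Type*} [NormedAddCommGroup H] [InnerProductSpace ℂ H] [CompleteSpace H]
    (ε : ℝ) (ρ : H →L[ℂ] H) : Set (H →L[ℂ] H) :=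
  {τ | τ ∈ subStates H ∧ purifiedDist τ ρ ≤ ε}

/-! ### Min-entropies -/

/-- The conditional min-entropy
`H_min(A|B)_ρ = sup_{σ ∈ D_≤(B)} sup {l ∈ ℝ | ρ ≤ exp(-l) (1_A ⊗ σ)}` with values in `[-∞, ∞]`. -/
def minEntropy {A B : Type*}
    [NormedAddCommGroup A] [InnerProductSpace ℂ A]
    [NormedAddCommGroup B] [InnerProductSpace ℂ B] [CompleteSpace B]
    (ρ : HTensor A B →L[ℂ] HTensor A B) : EReal :=
  ⨆ σ ∈ subStates B,
    ⨆ l ∈ {l : ℝ | ρ ≤ ((Real.exp (-l) : ℝ) : ℂ) • opTensor (ContinuousLinearMap.id ℂ A) σ},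
      (l : EReal)

/-- The smooth min-entropy `H^ε_min(A|B)_ρ`, the supremum of `H_min(A|B)` over `B^ε(ρ)`. -/
def smoothMinEntropy {A B : Type*}
    [NormedAddCommGroup A] [InnerProductSpace ℂ A]
    [NormedAddCommGroup B] [InnerProductSpace ℂ B] [CompleteSpace B]
    (ε : ℝ) (ρ : HTensor A B →L[ℂ] HTensor A B) : EReal :=
  ⨆ τ ∈ smoothBall ε ρ, minEntropy τ

/-! ### Subnormalised cq-states on `ABXY` -/

/-- A subnormalised cq-state `ρ_{ABXY} = ∑_{x,y} ρ_{AB}^{x,y} ⊗ |x⟩⟨x| ⊗ |y⟩⟨y|`, quantum on `AB`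
and classical on `XY`, given by its positive blocks `ρ_{AB}^{x,y}` (each being `p(x, y)` times a
conditional state), of total trace at most one. -/
structure CQState (A B X Y : Type*)
    [NormedAddCommGroup A] [InnerProductSpace ℂ A]
    [NormedAddCommGroup B] [InnerProductSpace ℂ B] where
  block : X × Y → (HTensor A B →L[ℂ] HTensor A B)
  block_nonneg : ∀ c, 0 ≤ block c
  trace_le_one : ∑' c, posTrace (block c) ≤ 1

section

variable {A B X Y : Type*}
  [NormedAddCommGroup A] [InnerProductSpace ℂ A] [CompleteSpace A]
  [NormedAddCommGroup B] [InnerProductSpace ℂ B] [CompleteSpace B]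

/-- The state `ρ ∧ Ω = ∑_{(x,y) ∈ Ω} ρ_{AB}^{x,y} ⊗ |x⟩⟨x| ⊗ |y⟩⟨y|`. -/
def CQState.restrict (ρ : CQState A B X Y) (Ω : Set (X × Y)) : CQState A B X Y where
  block := Ω.indicator ρ.block
  block_nonneg c := Set.indicator_apply_nonneg fun _ => ρ.block_nonneg c
  trace_le_one := by
    refine (ENNReal.tsum_le_tsum fun c => ?_).trans ρ.trace_le_one
    by_cases hc : c ∈ Ω
    · simp [hc]
    · simp [hc, posTrace]

/-- The operator `T ⊗ |x⟩⟨x|`, for `T` on `A ⊗ B`, with the tensor factors in the order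
`(A ⊗ X) ⊗ B`, i.e. `J T J†` with `J (a ⊗ b) = (a ⊗ |x⟩) ⊗ b`. -/
def insertReg (x : X) (T : HTensor A B →L[ℂ] HTensor A B) :
    HTensor (HTensor A (Reg X)) B →L[ℂ] HTensor (HTensor A (Reg X)) B :=
  let J := opTensor (addKet A x) (ContinuousLinearMap.id ℂ B)
  J ∘L T ∘L ContinuousLinearMap.adjoint J

/-- The density operator of a cq-state on `((A ⊗ X) ⊗ B) ⊗ Y`; the sum converges in norm. -/
def CQState.toOp (ρ : CQState A B X Y) :
    HTensor (HTensor (HTensor A (Reg X)) B) (Reg Y) →L[ℂ]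
      HTensor (HTensor (HTensor A (Reg X)) B) (Reg Y) :=
  ∑' c : X × Y, opTensor (insertReg c.1 (ρ.block c)) (ketbra c.2)

/-- The partial trace `Tr_Y R = ∑_y (1 ⊗ ⟨y|) R (1 ⊗ |y⟩)` over a classical register. -/
def traceReg {H : Type*} [NormedAddCommGroup H] [InnerProductSpace ℂ H] [CompleteSpace H]
    (R : HTensor H (Reg Y) →L[ℂ] HTensor H (Reg Y)) : H →L[ℂ] H :=
  ∑' y : Y, ContinuousLinearMap.adjoint (addKet H y) ∘L R ∘L addKet H y

/-- `H^ε_min(AX|B)_ρ` of a cq-state `ρ_{ABXY}`: the smooth min-entropy of its marginal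
`Tr_Y ρ` on `AXB`, with side information `B`. -/
def CQState.smoothMinEntropyAX (ε : ℝ) (ρ : CQState A B X Y) : EReal :=
  smoothMinEntropy (A := HTensor A (Reg X)) (B := B) ε (traceReg ρ.toOp)

end

end CQ

end

open scoped ENNReal TensorProduct

/-!
The marginal `Tr_Y ρ` is the norm-convergent sum of the blocks `ρ^{x,y} ⊗ |x⟩⟨x|`
(`CQ.CQState.traceReg_toOp`), so restricting to an event only drops positive summands: the marginal
of `ρ ∧ Ω` lies below the marginal of `ρ`. The classical structure plays no further role, because
the smooth min-entropy is antitone in its argument (`CQ.smoothMinEntropy_anti`).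

As the min-entropy is antitone as well, it suffices to show that, for substates `τ` and `ρ` and for
`0 ≤ ρ' ≤ ρ`, there is `0 ≤ τ' ≤ τ` with `F(τ', ρ') ≥ F(τ, ρ)` (`CQ.exists_le_fidelity_le`).
This is Uhlmann's argument followed by a measurement on the purifying system, with
Hilbert–Schmidt operators as purifications. By Douglas' lemma `√ρ' = W √ρ` for a contraction `W`.
Let `D† D = 1 - W† W`, and choose a contraction `V` with
`Tr |√τ √ρ| = Re ⟨V √τ, √ρ⟩` in the Hilbert–Schmidt inner product. Then
`Re ⟨V √τ, √ρ⟩ = Re ⟨W V √τ, √ρ'⟩ + Re ⟨D V √τ, D √ρ⟩`.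
With `τ' = n† n` and `n = W V √τ`, the first summand is at most `Tr |√τ' √ρ'|`, since `n` is a
contraction times `√τ'`. The Cauchy–Schwarz inequality bounds the second by a geometric mean of
discarded weights, at most `Tr τ - Tr τ'` and equal to `Tr ρ - Tr ρ'`. Another
application of Cauchy–Schwarz absorbs it into the term `√((1 - Tr τ) (1 - Tr ρ))` of the generalised
fidelity, which becomes at most `√((1 - Tr τ') (1 - Tr ρ'))`.

In place of trace class operators, only sums over an orthonormal basis of terms
`Re ⟪S eᵢ, T eᵢ⟫` with `S`, `T` Hilbert–Schmidt are used; cyclicity of the trace is the identity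
`CQ.hsInner_adjoint`, which follows by polarisation from `CQ.hsSq_adjoint`.
-/

noncomputable section

namespace CQ

/-! ### Positive operators and contractions -/

theorem norm_apply_le {H K : Type*} [NormedAddCommGroup H] [InnerProductSpace ℂ H]
    [NormedAddCommGroup K] [InnerProductSpace ℂ K] {U : H →L[ℂ] K} (hU : ‖U‖ ≤ 1) (v : H) :
    ‖U v‖ ≤ ‖v‖ :=
  (U.le_of_opNorm_le hU v).trans_eq (one_mul _)

/-- Douglas' factorisation lemma, with constant one. -/
theorem exists_contraction_comp_eq {H K L : Type*} [NormedAddCommGroup H]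
    [InnerProductSpace ℂ H] [NormedAddCommGroup K] [InnerProductSpace ℂ K] [CompleteSpace K]
    [NormedAddCommGroup L] [InnerProductSpace ℂ L] [CompleteSpace L]
    (S : H →L[ℂ] K) (T : H →L[ℂ] L) (h : ∀ v, ‖T v‖ ≤ ‖S v‖) :
    ∃ U : K →L[ℂ] L, ‖U‖ ≤ 1 ∧ U ∘L S = T := by
  let R : Submodule ℂ K := S.range.topologicalClosure
  have hmem : ∀ v, S v ∈ R := fun v => S.range.le_topologicalClosure ⟨v, rfl⟩
  let e : H →ₗ[ℂ] R := (S : H →ₗ[ℂ] K).codRestrict R hmem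
  have : CompleteSpace R := S.range.isClosed_topologicalClosure.completeSpace_coe
  have he : DenseRange e := by
    intro x
    rw [closure_subtype]
    have hx : (x : K) ∈ closure (S.range : Set K) := x.2
    convert hx using 2
    ext y
    constructor
    · rintro ⟨_, ⟨v, rfl⟩, rfl⟩
      exact ⟨v, rfl⟩
    · rintro ⟨v, rfl⟩
      exact ⟨_, ⟨v, rfl⟩, rfl⟩
  have hn : ∀ v, ‖(T : H →ₗ[ℂ] L) v‖ ≤ 1 * ‖e v‖ := fun v => by
    rw [one_mul]
    exact h v
  let V : R →L[ℂ] L := (T : H →ₗ[ℂ] L).extendOfNorm e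
  refine ⟨V ∘L R.orthogonalProjectionOnto, ?_, ?_⟩
  · refine (ContinuousLinearMap.opNorm_comp_le _ _).trans ?_
    exact mul_le_one₀ (LinearMap.opNorm_extendOfNorm_le he zero_le_one hn) (norm_nonneg _)
      R.orthogonalProjectionOnto_norm_le
  · ext v
    have h1 : R.orthogonalProjectionOnto (S v) = e v :=
      R.orthogonalProjectionOnto_mem_subspace_eq_self ⟨S v, hmem v⟩
    rw [ContinuousLinearMap.comp_apply, ContinuousLinearMap.comp_apply, h1]
    exact LinearMap.extendOfNorm_eq he ⟨1, hn⟩ v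

section Operators

variable {H K L : Type*}
  [NormedAddCommGroup H] [InnerProductSpace ℂ H] [CompleteSpace H]
  [NormedAddCommGroup K] [InnerProductSpace ℂ K] [CompleteSpace K]
  [NormedAddCommGroup L] [InnerProductSpace ℂ L] [CompleteSpace L]

theorem re_inner_nonneg {T : H →L[ℂ] H} (hT : 0 ≤ T) (v : H) : 0 ≤ (inner ℂ v (T v)).re := by
  rw [re_inner_eq hT]
  positivity

theorem adjoint_comp_self_nonneg (T : H →L[ℂ] K) : 0 ≤ ContinuousLinearMap.adjoint T ∘L T :=
  (ContinuousLinearMap.nonneg_iff_isPositive _).2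
    (ContinuousLinearMap.isPositive_adjoint_comp_self T)

theorem re_inner_adjoint_comp_self (T : H →L[ℂ] K) (v : H) :
    (inner ℂ v ((ContinuousLinearMap.adjoint T ∘L T) v)).re = ‖T v‖ ^ 2 := by
  rw [ContinuousLinearMap.comp_apply, ContinuousLinearMap.adjoint_inner_right,
    inner_self_eq_norm_sq_to_K]
  norm_cast

theorem le_of_re_inner_le {S T : H →L[ℂ] H} (hS : 0 ≤ S) (hT : 0 ≤ T)
    (h : ∀ v, (inner ℂ v (S v)).re ≤ (inner ℂ v (T v)).re) : S ≤ T := by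
  have hS' := ((ContinuousLinearMap.nonneg_iff_isPositive _).1 hS).isSelfAdjoint
  have hT' := ((ContinuousLinearMap.nonneg_iff_isPositive _).1 hT).isSelfAdjoint
  rw [ContinuousLinearMap.le_def, ContinuousLinearMap.isPositive_def]
  refine ⟨(hT'.sub hS').isSymmetric, fun v => ?_⟩
  rw [ContinuousLinearMap.reApplyInnerSelf_apply, inner_re_symm, sub_apply,
    inner_sub_right, map_sub]
  exact sub_nonneg.2 (h v)

theorem re_inner_le_of_le {S T : H →L[ℂ] H} (h : S ≤ T) (v : H) :
    (inner ℂ v (S v)).re ≤ (inner ℂ v (T v)).re := by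
  have := re_inner_nonneg (sub_nonneg.2 h) v
  rw [sub_apply, inner_sub_right, Complex.sub_re] at this
  linarith

theorem adjoint_sqrt (T : H →L[ℂ] H) :
    ContinuousLinearMap.adjoint (CFC.sqrt T) = CFC.sqrt T :=
  ((ContinuousLinearMap.nonneg_iff_isPositive _).1 (CFC.sqrt_nonneg T)).isSelfAdjoint.adjoint_eq

theorem adjoint_sqrt_comp_sqrt {T : H →L[ℂ] H} (hT : 0 ≤ T) :
    ContinuousLinearMap.adjoint (CFC.sqrt T) ∘L CFC.sqrt T = T := by
  rw [adjoint_sqrt]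
  exact CFC.sqrt_mul_sqrt_self T hT

theorem norm_abs_apply (T : H →L[ℂ] H) (v : H) : ‖CFC.abs T v‖ = ‖T v‖ := by
  have h : ‖CFC.abs T v‖ ^ 2 = ‖T v‖ ^ 2 := by
    rw [CFC.abs, ← re_inner_eq (star_mul_self_nonneg T), ← re_inner_adjoint_comp_self]
    rfl
  exact (sq_eq_sq₀ (norm_nonneg _) (norm_nonneg _)).1 h

/-- A defect operator `D` of a contraction `W`, that is `D† D = 1 - W† W`. -/
theorem exists_defect {W : H →L[ℂ] K} (hW : ‖W‖ ≤ 1) :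
    ∃ D : H →L[ℂ] H, ∀ u v : H,
      inner ℂ (W u) (W v) + inner ℂ (D u) (D v) = (inner ℂ u v : ℂ) := by
  have hnn : 0 ≤ ContinuousLinearMap.id ℂ H - ContinuousLinearMap.adjoint W ∘L W := by
    refine sub_nonneg.2 (le_of_re_inner_le (adjoint_comp_self_nonneg W) ?_ fun v => ?_)
    · exact (ContinuousLinearMap.nonneg_iff_isPositive _).2 ContinuousLinearMap.isPositive_one
    · rw [re_inner_adjoint_comp_self, ContinuousLinearMap.id_apply, inner_self_eq_norm_sq_to_K]
      norm_cast
      exact pow_le_pow_left₀ (norm_nonneg _) (norm_apply_le hW v) 2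
  refine ⟨CFC.sqrt (ContinuousLinearMap.id ℂ H - ContinuousLinearMap.adjoint W ∘L W),
    fun u v => ?_⟩
  have h := adjoint_sqrt_comp_sqrt hnn
  rw [← ContinuousLinearMap.adjoint_inner_right (CFC.sqrt _), ← ContinuousLinearMap.comp_apply, h,
    sub_apply, inner_sub_right, ContinuousLinearMap.comp_apply,
    ContinuousLinearMap.adjoint_inner_right]
  simp

/-- The polar decomposition `T = U |T|` of a bounded operator, in the form `U† T = |T|`. -/
theorem exists_polar (T : H →L[ℂ] H) :
    ∃ U : H →L[ℂ] H, ‖U‖ ≤ 1 ∧ U ∘L CFC.abs T = T ∧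
      ContinuousLinearMap.adjoint U ∘L T = CFC.abs T := by
  obtain ⟨U, hU, hUT⟩ := exists_contraction_comp_eq (CFC.abs T) T
    fun v => (norm_abs_apply T v).ge
  refine ⟨U, hU, hUT, ?_⟩
  obtain ⟨D, hD⟩ := exists_defect hU
  have hUv : ∀ v, U (CFC.abs T v) = T v := fun v => congrArg (· v) hUT
  -- `U` preserves the norm on the range of `|T|`, so the defect operator vanishes there.
  have hDv : ∀ v, D (CFC.abs T v) = 0 := fun v => by
    have h := hD (CFC.abs T v) (CFC.abs T v)
    rw [hUv, inner_self_eq_norm_sq_to_K, inner_self_eq_norm_sq_to_K (𝕜 := ℂ) (CFC.abs T v),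
      norm_abs_apply, add_eq_left] at h
    exact inner_self_eq_zero.1 h
  ext v
  refine ext_inner_left ℂ fun w => ?_
  rw [ContinuousLinearMap.comp_apply, ContinuousLinearMap.adjoint_inner_right, ← hD w, hDv,
    inner_zero_right, add_zero, hUv]

/-! ### Hilbert–Schmidt norm and inner product -/

/-- The squared Hilbert–Schmidt norm `Tr T† T ∈ [0, ∞]`. -/
def hsSq (T : H →L[ℂ] K) : ℝ≥0∞ :=
  posTrace (ContinuousLinearMap.adjoint T ∘L T)

theorem hsSq_eq_tsum {ι : Type*} (b : HilbertBasis ι ℂ H) (T : H →L[ℂ] K) :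
    hsSq T = ∑' i, ENNReal.ofReal (‖T (b i)‖ ^ 2) := by
  rw [hsSq, posTrace_eq (adjoint_comp_self_nonneg T) b]
  simp_rw [re_inner_adjoint_comp_self]

theorem posTrace_eq_hsSq_sqrt {T : H →L[ℂ] H} (hT : 0 ≤ T) : posTrace T = hsSq (CFC.sqrt T) := by
  rw [hsSq, adjoint_sqrt_comp_sqrt hT]

/-- Both sides are the sum of the squared absolute values of the matrix entries of `T`. -/
theorem hsSq_adjoint (T : H →L[ℂ] K) : hsSq (ContinuousLinearMap.adjoint T) = hsSq T := by
  obtain ⟨_, b, -⟩ := exists_hilbertBasis ℂ H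
  obtain ⟨_, c, -⟩ := exists_hilbertBasis ℂ K
  rw [hsSq_eq_tsum b, hsSq_eq_tsum c]
  simp_rw [ofReal_norm_sq_eq c (T _), ofReal_norm_sq_eq b (ContinuousLinearMap.adjoint T _),
    ContinuousLinearMap.adjoint_inner_right]
  rw [ENNReal.tsum_comm]
  simp_rw [norm_inner_symm (T _)]

theorem hsSq_mono {S : H →L[ℂ] K} {T : H →L[ℂ] L} (h : ∀ v, ‖S v‖ ≤ ‖T v‖) :
    hsSq S ≤ hsSq T := by
  obtain ⟨_, b, -⟩ := exists_hilbertBasis ℂ H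
  rw [hsSq_eq_tsum b, hsSq_eq_tsum b]
  exact ENNReal.tsum_le_tsum fun i => ENNReal.ofReal_le_ofReal (by gcongr; exact h _)

theorem hsSq_comp_le_left {U : K →L[ℂ] L} (hU : ‖U‖ ≤ 1) (T : H →L[ℂ] K) :
    hsSq (U ∘L T) ≤ hsSq T :=
  hsSq_mono fun v => norm_apply_le hU (T v)

theorem hsSq_comp_le_right {U : H →L[ℂ] K} (hU : ‖U‖ ≤ 1) (T : K →L[ℂ] L) :
    hsSq (T ∘L U) ≤ hsSq T := by
  rw [← hsSq_adjoint, ContinuousLinearMap.adjoint_comp, ← hsSq_adjoint T]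
  exact hsSq_comp_le_left (by rwa [LinearIsometryEquiv.norm_map]) _

theorem summable_of_hsSq_ne_top {ι : Type*} (b : HilbertBasis ι ℂ H) {T : H →L[ℂ] K}
    (hT : hsSq T ≠ ∞) : Summable fun i => ‖T (b i)‖ ^ 2 := by
  rw [hsSq_eq_tsum b] at hT
  refine (ENNReal.summable_toReal hT).congr fun i => ?_
  exact ENNReal.toReal_ofReal (by positivity)

theorem toReal_hsSq {ι : Type*} (b : HilbertBasis ι ℂ H) (T : H →L[ℂ] K) :
    (hsSq T).toReal = ∑' i, ‖T (b i)‖ ^ 2 := by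
  rw [hsSq_eq_tsum b, ENNReal.tsum_toReal_eq fun _ => ENNReal.ofReal_ne_top]
  exact tsum_congr fun i => ENNReal.toReal_ofReal (by positivity)

/-- Hilbert–Schmidt operators are closed under sums and differences, by the parallelogram law. -/
theorem hsSq_add_sub_ne_top {S T : H →L[ℂ] K} (hS : hsSq S ≠ ∞) (hT : hsSq T ≠ ∞) :
    hsSq (S + T) ≠ ∞ ∧ hsSq (S - T) ≠ ∞ := by
  obtain ⟨_, b, -⟩ := exists_hilbertBasis ℂ H
  have h : hsSq (S + T) + hsSq (S - T) = 2 * (hsSq S + hsSq T) := by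
    simp_rw [hsSq_eq_tsum b, ← ENNReal.tsum_add, ← ENNReal.tsum_mul_left]
    refine tsum_congr fun i => ?_
    rw [← ENNReal.ofReal_add (by positivity) (by positivity),
      ← ENNReal.ofReal_add (by positivity) (by positivity), ← ENNReal.ofReal_ofNat 2,
      ← ENNReal.ofReal_mul (by positivity)]
    congr 1
    have := parallelogram_law_with_norm ℂ (S (b i)) (T (b i))
    simp only [add_apply, sub_apply]
    linarith
  have h2 : hsSq (S + T) + hsSq (S - T) ≠ ∞ := by
    rw [h]
    exact ENNReal.mul_ne_top (by simp) (ENNReal.add_ne_top.2 ⟨hS, hT⟩)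
  exact ENNReal.add_ne_top.1 h2

/-- The real part of the Hilbert–Schmidt inner product `Tr S† T`, in an orthonormal basis `b`. -/
def hsInner {ι : Type*} (b : HilbertBasis ι ℂ H) (S T : H →L[ℂ] K) : ℝ :=
  ∑' i, (inner ℂ (S (b i)) (T (b i))).re

theorem summable_hsInner {ι : Type*} (b : HilbertBasis ι ℂ H) {S T : H →L[ℂ] K}
    (hS : hsSq S ≠ ∞) (hT : hsSq T ≠ ∞) :
    Summable fun i => (inner ℂ (S (b i)) (T (b i))).re := by
  refine Summable.of_norm_bounded
    ((summable_of_hsSq_ne_top b hS).add (summable_of_hsSq_ne_top b hT)) fun i => ?_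
  have h1 : ‖(inner ℂ (S (b i)) (T (b i))).re‖ ≤ ‖S (b i)‖ * ‖T (b i)‖ :=
    (Complex.abs_re_le_norm _).trans (norm_inner_le_norm _ _)
  nlinarith [sq_nonneg (‖S (b i)‖ - ‖T (b i)‖), sq_nonneg (‖S (b i)‖), sq_nonneg (‖T (b i)‖)]

theorem hsInner_eq_polarization {ι : Type*} (b : HilbertBasis ι ℂ H) {S T : H →L[ℂ] K}
    (hS : hsSq S ≠ ∞) (hT : hsSq T ≠ ∞) :
    hsInner b S T = ((hsSq (S + T)).toReal - (hsSq (S - T)).toReal) / 4 := by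
  obtain ⟨h1, h2⟩ := hsSq_add_sub_ne_top hS hT
  rw [toReal_hsSq b, toReal_hsSq b, ← (summable_of_hsSq_ne_top b h1).tsum_sub
    (summable_of_hsSq_ne_top b h2), ← tsum_div_const]
  refine tsum_congr fun i => ?_
  have h3 := re_inner_eq_norm_add_mul_self_sub_norm_sub_mul_self_div_four (𝕜 := ℂ)
    (S (b i)) (T (b i))
  simp only [add_apply, sub_apply, sq]
  exact h3

theorem hsInner_adjoint {ι : Type*} (b : HilbertBasis ι ℂ H) {S T : H →L[ℂ] H}
    (hS : hsSq S ≠ ∞) (hT : hsSq T ≠ ∞) :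
    hsInner b (ContinuousLinearMap.adjoint S) (ContinuousLinearMap.adjoint T) = hsInner b S T := by
  rw [hsInner_eq_polarization b hS hT, hsInner_eq_polarization b (by rwa [hsSq_adjoint])
    (by rwa [hsSq_adjoint]), ← map_add, ← map_sub, hsSq_adjoint, hsSq_adjoint]

theorem hsInner_le {ι : Type*} (b : HilbertBasis ι ℂ H) {S T : H →L[ℂ] K}
    (hS : hsSq S ≠ ∞) (hT : hsSq T ≠ ∞) :
    hsInner b S T ≤ √((hsSq S).toReal * (hsSq T).toReal) := by
  have hsS := summable_of_hsSq_ne_top b hS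
  have hsT := summable_of_hsSq_ne_top b hT
  have hpq : (2 : ℝ).HolderConjugate 2 := Real.HolderConjugate.two_two
  have hcs := Real.summable_and_inner_le_Lp_mul_Lq_tsum_of_nonneg hpq
    (fun i => norm_nonneg (S (b i))) (fun i => norm_nonneg (T (b i)))
    (by simpa using hsS) (by simpa using hsT)
  rw [Real.sqrt_mul ENNReal.toReal_nonneg, toReal_hsSq b, toReal_hsSq b, Real.sqrt_eq_rpow,
    Real.sqrt_eq_rpow]
  refine ((summable_hsInner b hS hT).tsum_le_tsum (fun i => ?_) hcs.1).trans
    (by simpa using hcs.2)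
  exact (Complex.re_le_norm _).trans (norm_inner_le_norm _ _)

/-! ### The trace norm -/

/-- Cyclicity: `Re ⟨V S, T⟩ = Re Tr (V S T†)`, the latter sum being convergent. -/
theorem hsInner_comp_eq {ι : Type*} (b : HilbertBasis ι ℂ H) {S T V : H →L[ℂ] H}
    (hV : ‖V‖ ≤ 1) (hS : hsSq S ≠ ∞) (hT : hsSq T ≠ ∞) :
    (Summable fun i =>
        (inner ℂ (b i) ((V ∘L S ∘L ContinuousLinearMap.adjoint T) (b i))).re) ∧
      hsInner b (V ∘L S) T
        = ∑' i, (inner ℂ (b i) ((V ∘L S ∘L ContinuousLinearMap.adjoint T) (b i))).re := by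
  have hVS := ne_top_of_le_ne_top hS (hsSq_comp_le_left hV S)
  have h : ∀ i, (inner ℂ (ContinuousLinearMap.adjoint (V ∘L S) (b i))
      (ContinuousLinearMap.adjoint T (b i))).re
        = (inner ℂ (b i) ((V ∘L S ∘L ContinuousLinearMap.adjoint T) (b i))).re := fun i => by
    rw [ContinuousLinearMap.adjoint_inner_left]
    rfl
  constructor
  · exact (summable_hsInner b (by rwa [hsSq_adjoint]) (by rwa [hsSq_adjoint])).congr h
  · rw [← hsInner_adjoint b hVS hT]
    exact tsum_congr h

/-- The trace norm of `S T†` is attained by `Re Tr (V S T†)` at a contraction `V`, the adjoint of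
the partial isometry in the polar decomposition. -/
theorem exists_posTrace_abs_eq_hsInner {ι : Type*} (b : HilbertBasis ι ℂ H) {S T : H →L[ℂ] H}
    (hS : hsSq S ≠ ∞) (hT : hsSq T ≠ ∞) :
    ∃ V : H →L[ℂ] H, ‖V‖ ≤ 1 ∧
      posTrace (CFC.abs (S ∘L ContinuousLinearMap.adjoint T))
        = ENNReal.ofReal (hsInner b (V ∘L S) T) := by
  obtain ⟨U, hU, -, hUT⟩ := exists_polar (S ∘L ContinuousLinearMap.adjoint T)
  have hU' : ‖ContinuousLinearMap.adjoint U‖ ≤ 1 := by rwa [LinearIsometryEquiv.norm_map]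
  have hP : 0 ≤ CFC.abs (S ∘L ContinuousLinearMap.adjoint T) := CFC.abs_nonneg _
  obtain ⟨hsum, heq⟩ := hsInner_comp_eq b hU' hS hT
  generalize CFC.abs (S ∘L ContinuousLinearMap.adjoint T) = P at hUT hP ⊢
  rw [hUT] at hsum heq
  exact ⟨ContinuousLinearMap.adjoint U, hU', by
    rw [heq, posTrace_eq hP b,
      ENNReal.ofReal_tsum_of_nonneg (fun i => re_inner_nonneg hP _) hsum]⟩

/-- `Re Tr (V S T†) ≤ ‖S T†‖₁` for every contraction `V`. -/
theorem hsInner_le_posTrace_abs {ι : Type*} (b : HilbertBasis ι ℂ H) {S T V : H →L[ℂ] H}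
    (hV : ‖V‖ ≤ 1) (hS : hsSq S ≠ ∞) (hT : hsSq T ≠ ∞) :
    hsInner b (V ∘L S) T
      ≤ (posTrace (CFC.abs (S ∘L ContinuousLinearMap.adjoint T))).toReal := by
  obtain ⟨U, hU, hUT, -⟩ := exists_polar (S ∘L ContinuousLinearMap.adjoint T)
  obtain ⟨V', -, hV'⟩ := exists_posTrace_abs_eq_hsInner b hS hT
  rw [(hsInner_comp_eq b hV hS hT).2]
  set P := CFC.abs (S ∘L ContinuousLinearMap.adjoint T)
  rw [← hUT]
  have hP0 : 0 ≤ P := CFC.abs_nonneg _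
  set Q := CFC.sqrt P
  have hQQ : Q ∘L Q = P := CFC.sqrt_mul_sqrt_self P hP0
  have hQtr : posTrace P = hsSq Q := posTrace_eq_hsSq_sqrt hP0
  have hQtop : hsSq Q ≠ ∞ := by
    rw [← hQtr, hV']
    exact ENNReal.ofReal_ne_top
  have hVU : ‖V ∘L U‖ ≤ 1 :=
    (ContinuousLinearMap.opNorm_comp_le _ _).trans (mul_le_one₀ hV (norm_nonneg _) hU)
  have hle : hsSq (ContinuousLinearMap.adjoint (V ∘L U ∘L Q)) ≤ hsSq Q := by
    rw [hsSq_adjoint]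
    exact hsSq_comp_le_left hVU Q
  -- Split `|S T†|` as `Q Q` and apply the Cauchy–Schwarz inequality to `(V U Q)†` and `Q`.
  have hsplit : ∑' i, (inner ℂ (b i) ((V ∘L U ∘L P) (b i))).re
      = hsInner b (ContinuousLinearMap.adjoint (V ∘L U ∘L Q)) Q := by
    refine tsum_congr fun i => ?_
    rw [ContinuousLinearMap.adjoint_inner_left, ← hQQ]
    rfl
  rw [hsplit, hQtr]
  refine (hsInner_le b (ne_top_of_le_ne_top hQtop hle) hQtop).trans ?_
  rw [Real.sqrt_le_left ENNReal.toReal_nonneg, sq]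
  exact mul_le_mul_of_nonneg_right (ENNReal.toReal_mono hQtop hle) ENNReal.toReal_nonneg

/-! ### Fidelity and restriction to a smaller operator -/

/-- The defect operator `D` keeps exactly the squared Hilbert–Schmidt norm that `W` loses. -/
theorem toReal_hsSq_defect {ι : Type*} (b : HilbertBasis ι ℂ H) {W D : H →L[ℂ] H}
    (hW : ‖W‖ ≤ 1)
    (hD : ∀ u v : H, inner ℂ (W u) (W v) + inner ℂ (D u) (D v) = (inner ℂ u v : ℂ))
    {T : H →L[ℂ] H} (hT : hsSq T ≠ ∞) :
    hsSq (D ∘L T) ≠ ∞ ∧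
      (hsSq (D ∘L T)).toReal = (hsSq T).toReal - (hsSq (W ∘L T)).toReal := by
  have hsq : ∀ v, ‖W v‖ ^ 2 + ‖D v‖ ^ 2 = ‖v‖ ^ 2 := fun v => by
    have := hD v v
    simp only [inner_self_eq_norm_sq_to_K] at this
    exact_mod_cast this
  have hDle : hsSq (D ∘L T) ≤ hsSq T := hsSq_mono fun v => by
    refine abs_le_of_sq_le_sq' ?_ (norm_nonneg _) |>.2
    have := hsq (T v)
    rw [ContinuousLinearMap.comp_apply]
    nlinarith [sq_nonneg ‖W (T v)‖]
  have hDtop := ne_top_of_le_ne_top hT hDle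
  have hWtop := ne_top_of_le_ne_top hT (hsSq_comp_le_left hW T)
  refine ⟨hDtop, ?_⟩
  rw [eq_sub_iff_add_eq, add_comm, toReal_hsSq b, toReal_hsSq b, toReal_hsSq b,
    ← (summable_of_hsSq_ne_top b hWtop).tsum_add (summable_of_hsSq_ne_top b hDtop)]
  exact tsum_congr fun i => hsq _

/-- Cauchy–Schwarz in the plane. -/
theorem sqrt_mul_add_sqrt_mul_le {a b c d : ℝ} (ha : 0 ≤ a) (hb : 0 ≤ b) (hc : 0 ≤ c)
    (hd : 0 ≤ d) : √(a * b) + √(c * d) ≤ √((a + c) * (b + d)) := by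
  apply Real.le_sqrt_of_sq_le
  have h1 : √(a * b) * √(c * d) = √(a * d) * √(c * b) := by
    rw [← Real.sqrt_mul (by positivity), ← Real.sqrt_mul (by positivity)]
    congr 1
    ring
  have h2 := Real.sq_sqrt (mul_nonneg ha hb)
  have h3 := Real.sq_sqrt (mul_nonneg hc hd)
  have h4 := Real.sq_sqrt (mul_nonneg ha hd)
  have h5 := Real.sq_sqrt (mul_nonneg hc hb)
  nlinarith [sq_nonneg (√(a * d) - √(c * b))]

theorem posTrace_mono {S T : H →L[ℂ] H} (hS : 0 ≤ S) (h : S ≤ T) : posTrace S ≤ posTrace T := by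
  obtain ⟨_, b, -⟩ := exists_hilbertBasis ℂ H
  rw [posTrace_eq hS b, posTrace_eq (hS.trans h) b]
  exact ENNReal.tsum_le_tsum fun i => ENNReal.ofReal_le_ofReal (re_inner_le_of_le h _)

/-- If `ρ` is cut down to `ρ' ≤ ρ`, then `τ` can be cut down to some `τ' ≤ τ` without decreasing
the generalised fidelity. -/
theorem exists_le_fidelity_le {τ ρ ρ' : H →L[ℂ] H} (hτ : τ ∈ subStates H) (hρ : ρ ∈ subStates H)
    (hρ' : 0 ≤ ρ') (hle : ρ' ≤ ρ) :
    ∃ τ' : H →L[ℂ] H, 0 ≤ τ' ∧ τ' ≤ τ ∧ fidelity τ ρ ≤ fidelity τ' ρ' := by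
  obtain ⟨_, b, -⟩ := exists_hilbertBasis ℂ H
  have hτtr : posTrace τ = hsSq (CFC.sqrt τ) := posTrace_eq_hsSq_sqrt hτ.1
  have hρtr : posTrace ρ = hsSq (CFC.sqrt ρ) := posTrace_eq_hsSq_sqrt hρ.1
  have hρ'tr : posTrace ρ' = hsSq (CFC.sqrt ρ') := posTrace_eq_hsSq_sqrt hρ'
  set s := CFC.sqrt τ
  set r := CFC.sqrt ρ with hr
  set r' := CFC.sqrt ρ' with hr'
  have hs : hsSq s ≠ ∞ := hτtr ▸ ne_top_of_le_ne_top ENNReal.one_ne_top hτ.2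
  have hrtop : hsSq r ≠ ∞ := hρtr ▸ ne_top_of_le_ne_top ENNReal.one_ne_top hρ.2
  -- `√ρ' = W √ρ`, so that `ρ' = √ρ W† W √ρ` is the first branch of a measurement of `ρ`.
  obtain ⟨W, hW, hWr⟩ := exists_contraction_comp_eq r r' fun v => by
    refine abs_le_of_sq_le_sq' ?_ (norm_nonneg _) |>.2
    rw [hr, hr', ← re_inner_eq hρ', ← re_inner_eq hρ.1]
    exact re_inner_le_of_le hle v
  obtain ⟨D, hD⟩ := exists_defect hW
  have hr'top : hsSq r' ≠ ∞ := by
    rw [← hWr]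
    exact ne_top_of_le_ne_top hrtop (hsSq_comp_le_left hW r)
  -- `(V √τ)†` purifies an operator below `τ`, and is aligned with `√ρ` as in Uhlmann's theorem.
  obtain ⟨V, hV, hVtr⟩ := exists_posTrace_abs_eq_hsInner b hs hrtop
  have hVs : hsSq (V ∘L s) ≠ ∞ := ne_top_of_le_ne_top hs (hsSq_comp_le_left hV s)
  set n := W ∘L V ∘L s with hn
  have hntop : hsSq n ≠ ∞ := ne_top_of_le_ne_top hVs (hsSq_comp_le_left hW _)
  have hns : ∀ v, ‖n v‖ ≤ ‖s v‖ := fun v =>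
    (norm_apply_le hW _).trans (norm_apply_le hV _)
  set τ' := ContinuousLinearMap.adjoint n ∘L n with hτ'
  have hτ'0 : 0 ≤ τ' := adjoint_comp_self_nonneg n
  have hτ'le : τ' ≤ τ := le_of_re_inner_le hτ'0 hτ.1 fun v => by
    rw [re_inner_adjoint_comp_self, re_inner_eq hτ.1]
    exact pow_le_pow_left₀ (norm_nonneg _) (hns v) 2
  refine ⟨τ', hτ'0, hτ'le, ?_⟩
  have hτ'tr : posTrace τ' = hsSq n := rfl
  have hs'n : ∀ v, ‖n v‖ ≤ ‖CFC.sqrt τ' v‖ := fun v => by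
    refine abs_le_of_sq_le_sq' ?_ (norm_nonneg _) |>.2
    rw [← re_inner_eq hτ'0, re_inner_adjoint_comp_self]
  obtain ⟨Z, hZ, hZn⟩ := exists_contraction_comp_eq _ n hs'n
  have hs'top : hsSq (CFC.sqrt τ') ≠ ∞ := by rwa [← posTrace_eq_hsSq_sqrt hτ'0, hτ'tr]
  obtain ⟨hDr, hDr'⟩ := toReal_hsSq_defect b hW hD hrtop
  obtain ⟨hDs, hDs'⟩ := toReal_hsSq_defect b hW hD hVs
  -- The two branches of the measurement `W† W + D† D = 1`.
  have hsplit : hsInner b (V ∘L s) r = hsInner b n r' + hsInner b (D ∘L V ∘L s) (D ∘L r) := by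
    rw [hsInner, hsInner, hsInner, ← (summable_hsInner b hntop hr'top).tsum_add
      (summable_hsInner b hDs hDr)]
    refine tsum_congr fun i => ?_
    rw [← hWr, ← Complex.add_re]
    exact congrArg Complex.re (hD _ _).symm
  have hfirst : hsInner b n r' ≤ (posTrace (CFC.abs (CFC.sqrt τ' * r'))).toReal := by
    have := hsInner_le_posTrace_abs b hZ hs'top hr'top
    rwa [hZn, adjoint_sqrt] at this
  have hsecond := hsInner_le b hDs hDr
  have htot : (posTrace (CFC.abs (s * r))).toReal
      ≤ (posTrace (CFC.abs (CFC.sqrt τ' * r'))).toReal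
        + √((hsSq (D ∘L V ∘L s)).toReal * (hsSq (D ∘L r)).toReal) := by
    rw [adjoint_sqrt] at hVtr
    rw [show s * r = s ∘L r from rfl, hVtr]
    rw [ENNReal.toReal_ofReal']
    exact max_le (by linarith) (by positivity)
  have hVs' : (hsSq (V ∘L s)).toReal ≤ (posTrace τ).toReal := by
    rw [hτtr]
    exact ENNReal.toReal_mono hs (hsSq_comp_le_left hV s)
  have hτ1 : (posTrace τ).toReal ≤ 1 :=
    ENNReal.toReal_le_of_le_ofReal zero_le_one (by simpa using hτ.2)
  have hρ1 : (posTrace ρ).toReal ≤ 1 :=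
    ENNReal.toReal_le_of_le_ofReal zero_le_one (by simpa using hρ.2)
  have hrest : √((hsSq (D ∘L V ∘L s)).toReal * (hsSq (D ∘L r)).toReal)
      + √((1 - (posTrace τ).toReal) * (1 - (posTrace ρ).toReal))
      ≤ √((1 - (posTrace τ').toReal) * (1 - (posTrace ρ').toReal)) := by
    refine (sqrt_mul_add_sqrt_mul_le ENNReal.toReal_nonneg ENNReal.toReal_nonneg
      (sub_nonneg.2 hτ1) (sub_nonneg.2 hρ1)).trans (Real.sqrt_le_sqrt ?_)
    have hρeq : (hsSq (D ∘L r)).toReal + (1 - (posTrace ρ).toReal) = 1 - (posTrace ρ').toReal := by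
      rw [hDr', hWr, hρtr, hρ'tr]
      ring
    have hτineq : (hsSq (D ∘L V ∘L s)).toReal + (1 - (posTrace τ).toReal)
        ≤ 1 - (posTrace τ').toReal := by
      rw [hDs', hτ'tr]
      linarith
    rw [hρeq]
    refine mul_le_mul_of_nonneg_right hτineq ?_
    rw [← hρeq]
    exact add_nonneg ENNReal.toReal_nonneg (sub_nonneg.2 hρ1)
  rw [fidelity, fidelity]
  refine pow_le_pow_left₀ (by positivity) ?_ 2
  linarith

end Operators

/-! ### Norm bounds for tensor products and positive operators -/

theorem norm_opTensor_le {H H' K K' : Type*}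
    [NormedAddCommGroup H] [InnerProductSpace ℂ H] [NormedAddCommGroup H'] [InnerProductSpace ℂ H']
    [NormedAddCommGroup K] [InnerProductSpace ℂ K] [NormedAddCommGroup K'] [InnerProductSpace ℂ K']
    (T : H →L[ℂ] H') (S : K →L[ℂ] K') : ‖opTensor T S‖ ≤ ‖T‖ * ‖S‖ := by
  refine le_trans ?_ (TensorProduct.norm_mapL_le T S)
  refine ContinuousLinearMap.opNorm_le_bound _ (norm_nonneg (TensorProduct.mapL T S)) fun v => ?_
  refine UniformSpace.Completion.induction_on
    (p := fun v : UniformSpace.Completion (H ⊗[ℂ] K) =>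
      ‖opTensor T S v‖ ≤ ‖TensorProduct.mapL T S‖ * ‖v‖) v ?_ fun a => ?_
  · exact isClosed_le (opTensor T S).continuous.norm (continuous_const.mul continuous_norm)
  · have h : opTensor T S (a : UniformSpace.Completion (H ⊗[ℂ] K))
        = ((TensorProduct.mapL T S a : H' ⊗[ℂ] K') : UniformSpace.Completion (H' ⊗[ℂ] K')) :=
      ContinuousLinearMap.completion_apply_coe _ _
    rw [h]
    refine (UniformSpace.Completion.norm_coe _).trans_le ?_
    rw [UniformSpace.Completion.norm_coe]
    exact ContinuousLinearMap.le_opNorm _ _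

theorem ket_eq_single {C : Type*} [DecidableEq C] (c : C) :
    (ket c : Reg C) = lp.single 2 c 1 := by
  rw [ket]
  congr
  exact Subsingleton.elim _ _

theorem inner_ket_ket {C : Type*} [DecidableEq C] (c d : C) :
    inner ℂ (ket c) (ket d) = (if c = d then 1 else 0 : ℂ) := by
  rw [ket_eq_single, ket_eq_single, lp.inner_single_left, lp.single_apply]
  split_ifs with h
  · subst h
    simp
  · rw [Pi.single_eq_of_ne h, inner_zero_right]

theorem norm_ket {C : Type*} (c : C) : ‖(ket c : Reg C)‖ = 1 := by
  classical
  rw [ket_eq_single, lp.norm_single (by norm_num), norm_one]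

theorem norm_ketbra_le {C : Type*} (c : C) : ‖(ketbra c : Reg C →L[ℂ] Reg C)‖ ≤ 1 := by
  simp [ketbra, norm_ket]

theorem ketbra_ket {C : Type*} [DecidableEq C] (c d : C) :
    ketbra c (ket d) = if c = d then (ket c : Reg C) else 0 := by
  rw [ketbra, InnerProductSpace.rankOne_apply, inner_ket_ket]
  split_ifs <;> simp

section

variable {H : Type*} [NormedAddCommGroup H] [InnerProductSpace ℂ H]

theorem norm_addKet_le {C : Type*} (c : C) : ‖addKet H c‖ ≤ 1 := by
  refine ContinuousLinearMap.opNorm_le_bound _ zero_le_one fun v => ?_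
  have h : ‖tmul v (ket c : Reg C)‖ ^ 2 = ‖v‖ ^ 2 := by
    have := inner_tmul v v (ket c : Reg C) (ket c)
    simp only [inner_self_eq_norm_sq_to_K, norm_ket] at this
    norm_num at this
    exact_mod_cast this
  rw [addKet_apply, one_mul]
  exact ((sq_eq_sq₀ (norm_nonneg _) (norm_nonneg _)).1 h).le

theorem tmul_zero_right {K : Type*} [NormedAddCommGroup K] [InnerProductSpace ℂ K] (h : H) :
    tmul h (0 : K) = 0 := by
  rw [tmul, TensorProduct.tmul_zero]
  rfl

variable [CompleteSpace H]

theorem norm_apply_sq_le_hsSq {K : Type*} [NormedAddCommGroup K] [InnerProductSpace ℂ K]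
    [CompleteSpace K] (T : H →L[ℂ] K) (v : H) :
    ENNReal.ofReal (‖T v‖ ^ 2) ≤ hsSq T * ENNReal.ofReal (‖v‖ ^ 2) := by
  obtain ⟨_, b, -⟩ := exists_hilbertBasis ℂ K
  rw [← hsSq_adjoint, hsSq_eq_tsum b, ofReal_norm_sq_eq b, ← ENNReal.tsum_mul_right]
  refine ENNReal.tsum_le_tsum fun i => ?_
  rw [← ENNReal.ofReal_mul (by positivity), ← mul_pow, ← ContinuousLinearMap.adjoint_inner_left]
  exact ENNReal.ofReal_le_ofReal (pow_le_pow_left₀ (norm_nonneg _) (norm_inner_le_norm _ _) 2)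

/-- The operator norm is at most the trace. This is what makes the sums over classical registers
converge in norm. -/
theorem norm_le_toReal_posTrace {T : H →L[ℂ] H} (hT : 0 ≤ T) (htr : posTrace T ≠ ∞) :
    ‖T‖ ≤ (posTrace T).toReal := by
  have hsqrt : ∀ v, ‖CFC.sqrt T v‖ ≤ √(posTrace T).toReal * ‖v‖ := fun v => by
    refine abs_le_of_sq_le_sq' ?_ (by positivity) |>.2
    have h := norm_apply_sq_le_hsSq (CFC.sqrt T) v
    rw [← posTrace_eq_hsSq_sqrt hT, ← ENNReal.ofReal_toReal htr,
      ← ENNReal.ofReal_mul ENNReal.toReal_nonneg,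
      ENNReal.ofReal_le_ofReal_iff (mul_nonneg ENNReal.toReal_nonneg (by positivity))] at h
    rwa [mul_pow, Real.sq_sqrt ENNReal.toReal_nonneg]
  refine ContinuousLinearMap.opNorm_le_bound _ ENNReal.toReal_nonneg fun v => ?_
  have hTv : T v = CFC.sqrt T (CFC.sqrt T v) :=
    congrArg (· v) (CFC.sqrt_mul_sqrt_self T hT).symm
  rw [hTv]
  refine (hsqrt _).trans ?_
  refine (mul_le_mul_of_nonneg_left (hsqrt v) (Real.sqrt_nonneg _)).trans_eq ?_
  rw [← mul_assoc, Real.mul_self_sqrt ENNReal.toReal_nonneg]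

theorem posTrace_tsum_le {ι : Type*} {T : ι → H →L[ℂ] H} (hT : ∀ i, 0 ≤ T i)
    (hsum : Summable T) :
    posTrace (∑' i, T i) ≤ ∑' i, posTrace (T i) := by
  obtain ⟨_, b, -⟩ := exists_hilbertBasis ℂ H
  rw [posTrace_eq (tsum_nonneg hT) b]
  simp_rw [posTrace_eq (hT _) b]
  rw [ENNReal.tsum_comm]
  refine ENNReal.tsum_le_tsum fun j => ?_
  let φ : (H →L[ℂ] H) →L[ℝ] ℝ :=
    Complex.reCLM ∘L (((innerSL ℂ (b j)) ∘L
      (ContinuousLinearMap.apply ℂ H (b j))).restrictScalars ℝ)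
  have hφ : ∀ S, φ S = (inner ℂ (b j) (S (b j))).re := fun _ => rfl
  simp_rw [← hφ]
  rw [φ.map_tsum hsum, ENNReal.ofReal_tsum_of_nonneg _ (hsum.mapL φ)]
  intro i
  rw [hφ]
  exact re_inner_nonneg (hT i) _

end

theorem summable_norm_of_tsum_posTrace {ι H : Type*} [NormedAddCommGroup H]
    [InnerProductSpace ℂ H] [CompleteSpace H] {T : ι → H →L[ℂ] H} (hT : ∀ i, 0 ≤ T i)
    (htr : ∑' i, posTrace (T i) ≠ ∞) :
    Summable fun i => ‖T i‖ :=
  Summable.of_nonneg_of_le (fun _ => norm_nonneg _)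
    (fun i => norm_le_toReal_posTrace (hT i) (ENNReal.ne_top_of_tsum_ne_top htr i))
    (ENNReal.summable_toReal htr)

/-! ### Marginals of cq-states -/

section

variable {A B X : Type*}
  [NormedAddCommGroup A] [InnerProductSpace ℂ A]
  [NormedAddCommGroup B] [InnerProductSpace ℂ B]

theorem norm_insertReg_isometry_le (x : X) :
    ‖opTensor (addKet A x) (ContinuousLinearMap.id ℂ B)‖ ≤ 1 :=
  (norm_opTensor_le _ _).trans (mul_le_one₀ (norm_addKet_le x) (norm_nonneg _)
    ContinuousLinearMap.norm_id_le)

/-- `insertReg x T` has the form `S† S`, where `S = √T J†` and `J` is the isometry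
`a ⊗ b ↦ (a ⊗ |x⟩) ⊗ b`. -/
theorem insertReg_eq (x : X) {T : HTensor A B →L[ℂ] HTensor A B} (hT : 0 ≤ T) :
    insertReg x T = ContinuousLinearMap.adjoint (CFC.sqrt T ∘L ContinuousLinearMap.adjoint
        (opTensor (addKet A x) (ContinuousLinearMap.id ℂ B))) ∘L
      (CFC.sqrt T ∘L ContinuousLinearMap.adjoint
        (opTensor (addKet A x) (ContinuousLinearMap.id ℂ B))) := by
  rw [ContinuousLinearMap.adjoint_comp, ContinuousLinearMap.adjoint_adjoint,
    ContinuousLinearMap.comp_assoc, ← ContinuousLinearMap.comp_assoc _ (CFC.sqrt T),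
    adjoint_sqrt_comp_sqrt hT]
  rfl

theorem insertReg_nonneg (x : X) {T : HTensor A B →L[ℂ] HTensor A B} (hT : 0 ≤ T) :
    0 ≤ insertReg x T := by
  rw [insertReg_eq x hT]
  exact adjoint_comp_self_nonneg _

theorem posTrace_insertReg_le (x : X) {T : HTensor A B →L[ℂ] HTensor A B} (hT : 0 ≤ T) :
    posTrace (insertReg x T) ≤ posTrace T := by
  rw [insertReg_eq x hT, posTrace_eq_hsSq_sqrt hT]
  exact hsSq_comp_le_right
    (by rw [LinearIsometryEquiv.norm_map]; exact norm_insertReg_isometry_le x) _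

end

section

variable {A B X Y : Type*}
  [NormedAddCommGroup A] [InnerProductSpace ℂ A] [CompleteSpace A]
  [NormedAddCommGroup B] [InnerProductSpace ℂ B] [CompleteSpace B]

/-- Compression of an operator on `H ⊗ ℓ²(Y)` to the block `(1 ⊗ ⟨y|) R (1 ⊗ |y⟩)`. -/
def compress {H : Type*} [NormedAddCommGroup H] [InnerProductSpace ℂ H] [CompleteSpace H]
    (y : Y) :
    (HTensor H (Reg Y) →L[ℂ] HTensor H (Reg Y)) →L[ℂ] (H →L[ℂ] H) :=
  (ContinuousLinearMap.compL ℂ H (HTensor H (Reg Y)) H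
      (ContinuousLinearMap.adjoint (addKet H y))) ∘L
    (ContinuousLinearMap.compL ℂ H (HTensor H (Reg Y)) (HTensor H (Reg Y))).flip (addKet H y)

theorem compress_opTensor_ketbra {H : Type*} [NormedAddCommGroup H] [InnerProductSpace ℂ H]
    [CompleteSpace H] [DecidableEq Y] (y z : Y) (T : H →L[ℂ] H) :
    compress y (opTensor T (ketbra z)) = if z = y then T else 0 := by
  ext v
  refine ext_inner_left ℂ fun w => ?_
  change inner ℂ w (ContinuousLinearMap.adjoint (addKet H y)
    (opTensor T (ketbra z) (addKet H y v))) = _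
  rw [ContinuousLinearMap.adjoint_inner_right, addKet_apply, addKet_apply, opTensor_tmul,
    ketbra_ket]
  split_ifs with h
  · rw [inner_tmul, h, inner_ket_ket, if_pos rfl, mul_one]
  · rw [tmul_zero_right, inner_zero_right, zero_apply, inner_zero_right]

namespace CQState

variable (ρ : CQState A B X Y)

theorem tsum_posTrace_insertReg_le_one :
    ∑' c, posTrace (insertReg c.1 (ρ.block c)) ≤ 1 := by
  have h : ∀ c, posTrace (insertReg c.1 (ρ.block c)) ≤ posTrace (ρ.block c) := fun c =>
    posTrace_insertReg_le c.1 (ρ.block_nonneg c)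
  exact le_trans (ENNReal.tsum_le_tsum h) ρ.trace_le_one

theorem summable_norm_insertReg : Summable fun c => ‖insertReg c.1 (ρ.block c)‖ :=
  summable_norm_of_tsum_posTrace (fun c => insertReg_nonneg c.1 (ρ.block_nonneg c))
    (ne_top_of_le_ne_top ENNReal.one_ne_top ρ.tsum_posTrace_insertReg_le_one)

/-- The marginal of a cq-state on `AXB` is the sum of its blocks `ρ^{x,y} ⊗ |x⟩⟨x|`. -/
theorem traceReg_toOp : traceReg ρ.toOp = ∑' c, insertReg c.1 (ρ.block c) := by
  classical
  have hI := ρ.summable_norm_insertReg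
  have hO : Summable fun c : X × Y => opTensor (insertReg c.1 (ρ.block c)) (ketbra c.2) := by
    refine Summable.of_norm_bounded hI fun c => (norm_opTensor_le _ _).trans ?_
    exact mul_le_of_le_one_right (norm_nonneg _) (norm_ketbra_le _)
  have hy : ∀ y : Y, compress y ρ.toOp = ∑' x, insertReg x (ρ.block (x, y)) := fun y => by
    rw [toOp, (compress y).map_tsum hO]
    simp_rw [compress_opTensor_ketbra]
    rw [← (Prod.mk_left_injective y).tsum_eq]
    · simp
    · intro c hc
      by_cases h : c.2 = y
      · exact ⟨c.1, by rw [← h]⟩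
      · simp [h] at hc
  have hswap : Summable fun p : Y × X => insertReg p.2 (ρ.block (p.2, p.1)) :=
    (Equiv.prodComm Y X).summable_iff.2 hI.of_norm
  calc traceReg ρ.toOp = ∑' y, compress y ρ.toOp := rfl
    _ = ∑' y, ∑' x, insertReg x (ρ.block (x, y)) := tsum_congr hy
    _ = ∑' p : Y × X, insertReg p.2 (ρ.block (p.2, p.1)) := hswap.tsum_prod.symm
    _ = ∑' c, insertReg c.1 (ρ.block c) :=
      (Equiv.prodComm Y X).tsum_eq fun c : X × Y => insertReg c.1 (ρ.block c)

theorem traceReg_toOp_mem_subStates :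
    traceReg ρ.toOp ∈ subStates (HTensor (HTensor A (Reg X)) B) := by
  have hnn : ∀ c, 0 ≤ insertReg c.1 (ρ.block c) := fun c => insertReg_nonneg _ (ρ.block_nonneg c)
  rw [traceReg_toOp]
  exact ⟨tsum_nonneg hnn, (posTrace_tsum_le hnn ρ.summable_norm_insertReg.of_norm).trans
    ρ.tsum_posTrace_insertReg_le_one⟩

theorem traceReg_toOp_restrict_le (Ω : Set (X × Y)) :
    traceReg (ρ.restrict Ω).toOp ≤ traceReg ρ.toOp := by
  rw [traceReg_toOp, traceReg_toOp]
  refine Summable.tsum_le_tsum (fun c => ?_) (ρ.restrict Ω).summable_norm_insertReg.of_norm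
    ρ.summable_norm_insertReg.of_norm
  by_cases hc : c ∈ Ω
  · simp [restrict, hc]
  · have h0 : insertReg c.1 ((ρ.restrict Ω).block c) = 0 := by
      simp [restrict, hc, insertReg]
    rw [h0]
    exact insertReg_nonneg _ (ρ.block_nonneg c)

end CQState

end

/-! ### Monotonicity of the min-entropies -/

section

variable {A B : Type*} [NormedAddCommGroup A] [InnerProductSpace ℂ A]
  [NormedAddCommGroup B] [InnerProductSpace ℂ B] [CompleteSpace B]

theorem minEntropy_anti {ρ τ : HTensor A B →L[ℂ] HTensor A B} (h : ρ ≤ τ) :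
    minEntropy τ ≤ minEntropy ρ := by
  refine iSup₂_mono fun σ _ => iSup₂_le fun l hl => ?_
  exact le_iSup₂_of_le (f := fun (l : ℝ) _ => (l : EReal)) l (h.trans hl) le_rfl

/-- The smooth min-entropy is antitone: each `τ` in the ball around `ρ` dominates some `τ'` in the
ball around `ρ'`. -/
theorem smoothMinEntropy_anti (ε : ℝ) {ρ ρ' : HTensor A B →L[ℂ] HTensor A B}
    (hρ : ρ ∈ subStates (HTensor A B)) (hρ' : 0 ≤ ρ') (hle : ρ' ≤ ρ) :
    smoothMinEntropy ε ρ ≤ smoothMinEntropy ε ρ' := by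
  refine iSup₂_le fun τ hτ => ?_
  obtain ⟨τ', hτ'0, hτ'le, hF⟩ := exists_le_fidelity_le hτ.1 hρ hρ' hle
  have hτ' : τ' ∈ smoothBall ε ρ' :=
    ⟨⟨hτ'0, (posTrace_mono hτ'0 hτ'le).trans hτ.1.2⟩,
      (Real.sqrt_le_sqrt (sub_le_sub_left hF 1)).trans hτ.2⟩
  exact le_iSup₂_of_le (f := fun τ (_ : τ ∈ smoothBall ε ρ') => minEntropy τ) τ' hτ'
    (minEntropy_anti hτ'le)

end

end CQ

end
theorem mainTheorem3 {A B X Y : Type*}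
    [NormedAddCommGroup A] [InnerProductSpace ℂ A] [CompleteSpace A]
    [TopologicalSpace.SeparableSpace A]
    [NormedAddCommGroup B] [InnerProductSpace ℂ B] [CompleteSpace B]
    [TopologicalSpace.SeparableSpace B]
    [Countable X] [Countable Y]
    (ρ : CQ.CQState A B X Y) (Ω : Set (X × Y)) (ε : ℝ) (hε : 0 < ε) :
    (ρ.restrict Ω).smoothMinEntropyAX ε ≥ ρ.smoothMinEntropyAX ε :=
  CQ.smoothMinEntropy_anti ε ρ.traceReg_toOp_mem_subStates
    (ρ.restrict Ω).traceReg_toOp_mem_subStates.1 (ρ.traceReg_toOp_restrict_le Ω)
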